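/- Let $(\mathcal C,\mathbb E,\mathfrak s)$ be a Krull--Schmidt extriangulated category (in the sense of Nakaoka and Palu) with enough projectives and enough injectives, and let $\mathbb E^{i}$ ($i\ge 1$) denote its higher extension groups, $\mathbb E^{i+1}(X,Y)=\mathbb E(\Omega^{i}X,Y)$ for $i\ge 0$, where $\Omega^iX$ is an $i$-th syzygy of $X$. Let $\omega$ be a full additive subcategory of $\mathcal C$, closed under isomorphisms and direct summands, which is self-orthogonal, i.e. $\mathbb E^{i}(X,Y)=0$ for all $X,Y\in\omega$ and all $i\ge 1$. Write $\omega^{\perp}$ for the class of objects $Y$ with $\mathbb E^{i}(X,Y)=0$ for all $X\in\omega$ and $i\ge 1$. For a class $\mathcal Y$ of objects of $\mathcal C$, let $\hat{\mathcal Y}_0=\check{\mathcal Y}_0$ be the class of objects isomorphic to an object of $\mathcal Y$. For $n\ge 0$, let $\hat{\mathcal Y}_{n+1}$ be the class of objects $A$ for which there is an $\mathbb E$-triangle $K\to Y\to A\dashrightarrow$ with $Y\in\mathcal Y$ and $K\in\hat{\mathcal Y}_n$, and let $\check{\mathcal Y}_{n+1}$ be the class of objects $A$ for which there is an $\mathbb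 E$-triangle $A\to Y\to K\dashrightarrow$ with $Y\in\mathcal Y$ and $K\in\check{\mathcal Y}_n$. (So $A\in\hat{\mathcal Y}_n$ means that there is an $\mathbb E$-triangle sequence $Y_n\to\cdots\to Y_0\to A$ with all $Y_i\in\mathcal Y$, and dually for $\check{\mathcal Y}_n$.) Put $\hat{\mathcal Y}=\bigcup_{n\ge0}\hat{\mathcal Y}_n$, $\check{\mathcal Y}=\bigcup_{n\ge 0}\check{\mathcal Y}_n$ and $\widetilde{\omega}=\check{\hat{\omega}}$, that is, $\check{\mathcal Y}$ for $\mathcal Y=\hat\omega$. Let ${}_\omega\mathcal X$ be the class of objects $A$ for which there are $\mathbb E$-triangles $K_{n+1}\to W_n\to K_n\dashrightarrow$ ($n\ge 0$) with $K_0=A$, all $W_n\in\omega$ and all $K_n\in\omega^{\perp}$. Then each of the two classes $\mathcal Z=\check{({}_\omega\mathcal X)}$ and $\mathcal Z=\widetilde{\omega}$ is closed under extensions, under cocones of deflations, and under cones of inflations; that is, for every $\mathbb E$-triangle $L\to M\to N\dashrightarrow$: 1. if $L,N\in\mathcal Z$, then $M\in\mathcal Z$; 2. if $M,N\in\mathcal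 Z$, then $L\in\mathcal Z$; 3. if $L,M\in\mathcal Z$, then $N\in\mathcal Z$. -/

import Mathlib

open CategoryTheory CategoryTheory.Limits Opposite

universe w v u

namespace Extri

section Basic

variable {C : Type u} [Category.{v} C]

/-- A sequence of two composable morphisms `A ⟶ mid ⟶ Z` with fixed ends `A` and `Z`. -/
structure ShortSeq (A Z : C) where
  mid : C
  inc : A ⟶ mid
  proj : mid ⟶ Z

/-- Two sequences `A ⟶ B ⟶ Z` and `A ⟶ B' ⟶ Z` are equivalent if there is an isomorphism
`B ≅ B'` compatible with the identities of `A` and `Z`. -/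
instance ShortSeq.setoid (A Z : C) : Setoid (ShortSeq A Z) where
  r s t := ∃ b : s.mid ≅ t.mid, s.inc ≫ b.hom = t.inc ∧ b.hom ≫ t.proj = s.proj
  iseqv :=
    { refl := fun s => ⟨Iso.refl _, by simp, by simp⟩
      symm := by
        rintro s t ⟨b, h₁, h₂⟩
        exact ⟨b.symm, by simp [← h₁], by simp [← h₂]⟩
      trans := by
        rintro s t r ⟨b, h₁, h₂⟩ ⟨c, h₃, h₄⟩
        exact ⟨b ≪≫ c, by simp [← h₃, ← h₁], by simp [← h₂, ← h₄]⟩ }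

/-- Equivalence classes of sequences `A ⟶ B ⟶ Z`. -/
abbrev SeqClass (A Z : C) := Quotient (ShortSeq.setoid A Z)

/-- The equivalence class `[A ⟶ B ⟶ Z]`. -/
def seqClass {A B Z : C} (x : A ⟶ B) (y : B ⟶ Z) : SeqClass A Z :=
  Quotient.mk _ ⟨B, x, y⟩

/-- The group `E(Z, A)` of `E`-extensions. -/
abbrev ExtOf (E : Cᵒᵖ ⥤ C ⥤ AddCommGrpCat.{w}) (Z A : C) : Type w :=
  (E.obj (op Z)).obj A

/-- The push-forward `a_* δ = E(Z, a)(δ)`. -/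
def push (E : Cᵒᵖ ⥤ C ⥤ AddCommGrpCat.{w}) {Z A A' : C} (a : A ⟶ A') (δ : ExtOf E Z A) :
    ExtOf E Z A' :=
  ((E.obj (op Z)).map a).hom δ

/-- The pull-back `c^* δ = E(c, A)(δ)`. -/
def pull (E : Cᵒᵖ ⥤ C ⥤ AddCommGrpCat.{w}) {Z Z' A : C} (c : Z' ⟶ Z) (δ : ExtOf E Z A) :
    ExtOf E Z' A :=
  ((E.map c.op).app A).hom δ

/-- The extension `δ ⊕ δ' ∈ E(Z ⊕ Z', A ⊕ A')`: the element whose four components in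
`E(Z, A)`, `E(Z, A')`, `E(Z', A)`, `E(Z', A')` are `δ`, `0`, `0`, `δ'`. -/
noncomputable def extSum [Preadditive C] [HasBinaryBiproducts C]
    (E : Cᵒᵖ ⥤ C ⥤ AddCommGrpCat.{w}) {Z A Z' A' : C}
    (δ : ExtOf E Z A) (δ' : ExtOf E Z' A') : ExtOf E (Z ⊞ Z') (A ⊞ A') :=
  push E biprod.inl (pull E biprod.fst δ) + push E biprod.inr (pull E biprod.snd δ')

end Basic

/-- The structure of an extriangulated category (in the sense of Nakaoka and Palu) on an additive
category `C`: a biadditive functor `E : Cᵒᵖ × C ⥤ Ab` (written in curried form) together with an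
additive realization `s` of it, subject to the axioms below. -/
structure ExtriangulatedStructure (C : Type u) [Category.{v} C] [Preadditive C]
    [HasZeroObject C] [HasBinaryBiproducts C] where
  /-- The bifunctor `E`. -/
  E : Cᵒᵖ ⥤ C ⥤ AddCommGrpCat.{w}
  /-- (ET1): `E` is additive in the first variable. -/
  additive_left : ∀ {Z Z' : C} (A : C) (c c' : Z' ⟶ Z) (δ : ExtOf E Z A),
    pull E (c + c') δ = pull E c δ + pull E c' δ
  /-- (ET1): `E` is additive in the second variable. -/
  additive_right : ∀ (Z : C) {A A' : C} (a a' : A ⟶ A') (δ : ExtOf E Z A),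
    push E (a + a') δ = push E a δ + push E a' δ
  /-- The correspondence `s`, sending `δ ∈ E(Z, A)` to an equivalence class `[A ⟶ B ⟶ Z]`. -/
  s : ∀ {Z A : C}, ExtOf E Z A → SeqClass A Z
  /-- (ET2): `s` is a realization of `E`. -/
  realization : ∀ {A B Z A' B' Z' : C} (δ : ExtOf E Z A) (δ' : ExtOf E Z' A')
    (x : A ⟶ B) (y : B ⟶ Z) (x' : A' ⟶ B') (y' : B' ⟶ Z') (a : A ⟶ A') (c : Z ⟶ Z'),
    s δ = seqClass x y → s δ' = seqClass x' y' → push E a δ = pull E c δ' →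
    ∃ b : B ⟶ B', x ≫ b = a ≫ x' ∧ y ≫ c = b ≫ y'
  /-- (ET2): the realization `s` sends `0` to the split sequence. -/
  s_zero : ∀ (Z A : C),
    s (0 : ExtOf E Z A) = seqClass (biprod.inl : A ⟶ A ⊞ Z) (biprod.snd : A ⊞ Z ⟶ Z)
  /-- (ET2): the realization `s` is compatible with direct sums. -/
  s_sum : ∀ {A B Z A' B' Z' : C} (δ : ExtOf E Z A) (δ' : ExtOf E Z' A')
    (x : A ⟶ B) (y : B ⟶ Z) (x' : A' ⟶ B') (y' : B' ⟶ Z'),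
    s δ = seqClass x y → s δ' = seqClass x' y' →
    s (extSum E δ δ') = seqClass (biprod.map x x') (biprod.map y y')
  /-- (ET3). -/
  et3 : ∀ {A B Z A' B' Z' : C} (δ : ExtOf E Z A) (δ' : ExtOf E Z' A')
    (x : A ⟶ B) (y : B ⟶ Z) (x' : A' ⟶ B') (y' : B' ⟶ Z') (a : A ⟶ A') (b : B ⟶ B'),
    s δ = seqClass x y → s δ' = seqClass x' y' → x ≫ b = a ≫ x' →
    ∃ c : Z ⟶ Z', push E a δ = pull E c δ' ∧ y ≫ c = b ≫ y'
  /-- The dual of (ET3). -/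
  et3_op : ∀ {A B Z A' B' Z' : C} (δ : ExtOf E Z A) (δ' : ExtOf E Z' A')
    (x : A ⟶ B) (y : B ⟶ Z) (x' : A' ⟶ B') (y' : B' ⟶ Z') (b : B ⟶ B') (c : Z ⟶ Z'),
    s δ = seqClass x y → s δ' = seqClass x' y' → y ≫ c = b ≫ y' →
    ∃ a : A ⟶ A', push E a δ = pull E c δ' ∧ x ≫ b = a ≫ x'
  /-- (ET4): for `A ⟶ B ⟶ D` realizing `δ` and `B ⟶ Y ⟶ F` realizing `δ'`. -/
  et4 : ∀ {A B D Y F : C} (δ : ExtOf E D A) (δ' : ExtOf E F B)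
    (f : A ⟶ B) (f' : B ⟶ D) (g : B ⟶ Y) (g' : Y ⟶ F),
    s δ = seqClass f f' → s δ' = seqClass g g' →
    ∃ (X : C) (h : A ⟶ Y) (h' : Y ⟶ X) (d : D ⟶ X) (e : X ⟶ F) (δ'' : ExtOf E X A),
      h = f ≫ g ∧ f' ≫ d = g ≫ h' ∧ h' ≫ e = g' ∧
      s δ'' = seqClass h h' ∧
      s (push E f' δ') = seqClass d e ∧
      pull E d δ'' = δ ∧
      push E f δ'' = pull E e δ'
  /-- The dual of (ET4): for `D ⟶ A ⟶ B` realizing `δ` and `F ⟶ B ⟶ Y` realizing `δ'`. -/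
  et4_op : ∀ {A B D Y F : C} (δ : ExtOf E B D) (δ' : ExtOf E Y F)
    (f' : D ⟶ A) (f : A ⟶ B) (g' : F ⟶ B) (g : B ⟶ Y),
    s δ = seqClass f' f → s δ' = seqClass g' g →
    ∃ (X : C) (h' : X ⟶ A) (h : A ⟶ Y) (d : D ⟶ X) (e : X ⟶ F) (δ'' : ExtOf E Y X),
      h = f ≫ g ∧ h' ≫ f = e ≫ g' ∧ d ≫ h' = f' ∧
      s δ'' = seqClass h' h ∧
      s (pull E g' δ) = seqClass d e ∧
      push E e δ'' = δ' ∧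
      pull E g δ'' = push E d δ

section Additive

variable (C : Type u) [Category.{v} C] [Preadditive C] [HasZeroObject C] [HasBinaryBiproducts C]

/-- `C` is Krull–Schmidt: every object is a finite direct sum of objects with local
endomorphism rings. -/
def IsKrullSchmidt : Prop :=
  ∀ X : C, ∃ (n : ℕ) (f : Fin n → C),
    (∀ i, IsLocalRing (End (f i))) ∧ ∃ b : Bicone f, Nonempty b.IsBilimit ∧ Nonempty (X ≅ b.pt)

variable {C}

/-- A full additive subcategory of `C`, given by its class of objects, that is closed under
isomorphisms and direct summands. -/
structure IsAdditiveSubcategory (ω : ObjectProperty C) : Prop where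
  zero : ∀ X : C, IsZero X → ω X
  iso : ∀ {X Y : C}, (X ≅ Y) → ω X → ω Y
  sum : ∀ {X Y : C}, ω X → ω Y → ω (X ⊞ Y)
  summand : ∀ {X Y : C}, ω (X ⊞ Y) → ω X

end Additive

namespace ExtriangulatedStructure

variable {C : Type u} [Category.{v} C] [Preadditive C] [HasZeroObject C] [HasBinaryBiproducts C]
  (S : ExtriangulatedStructure.{w} C)

/-- `A ⟶ B ⟶ Z` is a conflation, i.e. it is part of an `E`-triangle `A ⟶ B ⟶ Z ⇢`. -/
def IsConflation {A B Z : C} (x : A ⟶ B) (y : B ⟶ Z) : Prop :=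
  ∃ δ : ExtOf S.E Z A, S.s δ = seqClass x y

/-- `P` is projective with respect to the `E`-triangles. -/
def IsProjective (P : C) : Prop :=
  ∀ {A B Z : C} (x : A ⟶ B) (y : B ⟶ Z), S.IsConflation x y →
    ∀ c : P ⟶ Z, ∃ b : P ⟶ B, b ≫ y = c

/-- `I` is injective with respect to the `E`-triangles. -/
def IsInjective (I : C) : Prop :=
  ∀ {A B Z : C} (x : A ⟶ B) (y : B ⟶ Z), S.IsConflation x y →
    ∀ a : A ⟶ I, ∃ b : B ⟶ I, x ≫ b = a

/-- Every object `Z` admits an `E`-triangle `K ⟶ P ⟶ Z ⇢` with `P` projective. -/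
class EnoughProjectives : Prop where
  exists_conflation : ∀ Z : C, ∃ (K P : C) (x : K ⟶ P) (y : P ⟶ Z),
    S.IsConflation x y ∧ S.IsProjective P

/-- Every object `A` admits an `E`-triangle `A ⟶ I ⟶ K ⇢` with `I` injective. -/
class EnoughInjectives : Prop where
  exists_conflation : ∀ A : C, ∃ (K I : C) (x : A ⟶ I) (y : I ⟶ K),
    S.IsConflation x y ∧ S.IsInjective I

section Higher

variable [S.EnoughProjectives]

/-- A (chosen) syzygy `Ω X`: there is an `E`-triangle `Ω X ⟶ P ⟶ X ⇢` with `P` projective. -/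
noncomputable def syzygy (X : C) : C :=
  (EnoughProjectives.exists_conflation (S := S) X).choose

/-- The iterated syzygy `Ω^i X`. -/
noncomputable def iterSyzygy : ℕ → C → C
  | 0, X => X
  | i + 1, X => S.syzygy (iterSyzygy i X)

/-- The higher extension group `E^{i+1}(X, Y) = E(Ω^i X, Y)`. -/
abbrev ExtSucc (i : ℕ) (X Y : C) : Type w :=
  ExtOf S.E (S.iterSyzygy i X) Y

/-- `ω^⊥`: the objects `Y` with `E^i(X, Y) = 0` for all `i ≥ 1` and all `X` in `ω`. -/
def rightPerp (ω : ObjectProperty C) : ObjectProperty C :=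
  fun Y => ∀ X : C, ω X → ∀ (i : ℕ) (δ : S.ExtSucc i X Y), δ = 0

/-- `ω` is self-orthogonal: `E^i(X, Y) = 0` for all `i ≥ 1` and all `X`, `Y` in `ω`. -/
def IsSelfOrthogonal (ω : ObjectProperty C) : Prop :=
  ω ≤ S.rightPerp ω

/-- `_ω𝒳`: the objects `A` for which there is an `E`-triangle sequence
`⋯ ⟶ W 2 ⟶ W 1 ⟶ W 0 ⟶ A`, spliced from `E`-triangles `K (n + 1) ⟶ W n ⟶ K n ⇢` with `K 0 = A`,
where each `W n` lies in `ω` and each `K n` lies in `ω^⊥`. -/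
def leftX (ω : ObjectProperty C) : ObjectProperty C :=
  fun A => ∃ W K : ℕ → C, K 0 = A ∧ ∀ n : ℕ,
    ω (W n) ∧ S.rightPerp ω (K n) ∧
    ∃ (g : K (n + 1) ⟶ W n) (f : W n ⟶ K n), S.IsConflation g f

end Higher

/-- The objects `A` that admit an `E`-triangle sequence `W n ⟶ ⋯ ⟶ W 1 ⟶ W 0 ⟶ A` with each
`W i` in `ω`: for `n = 0` this says `W 0 ≅ A`, and for `n + 1` it is spliced from an `E`-triangle
`K ⟶ W 0 ⟶ A ⇢` and such a sequence of length `n` ending in `K`. -/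
def hatN (ω : ObjectProperty C) : ℕ → ObjectProperty C
  | 0 => fun A => ∃ W : C, ω W ∧ Nonempty (W ≅ A)
  | n + 1 => fun A => ∃ (K W : C) (g : K ⟶ W) (f : W ⟶ A),
      ω W ∧ hatN ω n K ∧ S.IsConflation g f

/-- The objects `A` that admit an `E`-triangle sequence `A ⟶ W 0 ⟶ W 1 ⟶ ⋯ ⟶ W n` with each
`W i` in `ω`: for `n = 0` this says `A ≅ W 0`, and for `n + 1` it is spliced from an `E`-triangle
`A ⟶ W 0 ⟶ K ⇢` and such a sequence of length `n` starting in `K`. -/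
def checkN (ω : ObjectProperty C) : ℕ → ObjectProperty C
  | 0 => fun A => ∃ W : C, ω W ∧ Nonempty (A ≅ W)
  | n + 1 => fun A => ∃ (K W : C) (g : A ⟶ W) (f : W ⟶ K),
      ω W ∧ checkN ω n K ∧ S.IsConflation g f

/-- `ω̂`, the union of all `ω̂_n`. -/
def hat (ω : ObjectProperty C) : ObjectProperty C := fun A => ∃ n : ℕ, S.hatN ω n A

/-- `ω̌`, the union of all `ω̌_n`. -/
def check (ω : ObjectProperty C) : ObjectProperty C := fun A => ∃ n : ℕ, S.checkN ω n A

/-- `ω̃ = (ω̂)ˇ`. -/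
def tilde (ω : ObjectProperty C) : ObjectProperty C := S.check (S.hat ω)

/-- Closure under extensions. -/
def ClosedUnderExtensions (P : ObjectProperty C) : Prop :=
  ∀ {L M N : C} (x : L ⟶ M) (y : M ⟶ N), S.IsConflation x y → P L → P N → P M

/-- Closure under cocones of deflations. -/
def ClosedUnderCocones (P : ObjectProperty C) : Prop :=
  ∀ {L M N : C} (x : L ⟶ M) (y : M ⟶ N), S.IsConflation x y → P M → P N → P L

/-- Closure under cones of inflations. -/
def ClosedUnderCones (P : ObjectProperty C) : Prop :=
  ∀ {L M N : C} (x : L ⟶ M) (y : M ⟶ N), S.IsConflation x y → P L → P M → P N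

end ExtriangulatedStructure

end Extri

/-! Both classes have the form `S.check X` with `X` inside `ω^⊥`, closed under extensions and under
cones of inflations, and such that every object of `X` is the end of an `E`-triangle `K ⟶ W ⟶ A`
with `W` in `ω` and `K` in `X`: take `X = leftX ω` or `X = hat ω`. This is packaged as
`IsRelativeGenerator`, and the theorem is proved once for any such `X`.

The engine is Auslander–Buchweitz approximation. Every `A` in `check X` admits `K ⟶ Y ⟶ A`
(`exists_precover`) and `A ⟶ E ⟶ Y'` (`exists_preenvelope`) with `K`, `E` in `X` and `Y`, `Y'` in
`check ω`. Since `check ω` is orthogonal to `ω^⊥`, hence to `X`, the horseshoe construction applies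
to the envelopes and gives closure under extensions. Cocones and cones then reduce to extensions: a
pullback, pushout or composition replaces the given triangle by triangles whose middle terms are
extensions of objects already under control. -/

namespace Extri

/-! ### Functoriality of push-forward and pull-back of extensions. -/

section Basic

lemma isIso_of_isIso_comp {C : Type u} [Category.{v} C] {B B' : C} (b : B ⟶ B') (b' : B' ⟶ B) (h : IsIso (b ≫ b'))
    (h' : IsIso (b' ≫ b)) : IsIso b := by
  have : IsSplitMono b := ⟨⟨⟨b' ≫ inv (b ≫ b'), by rw [← Category.assoc, IsIso.hom_inv_id]⟩⟩⟩
  have : IsSplitEpi b := ⟨⟨⟨inv (b' ≫ b) ≫ b', by rw [Category.assoc, IsIso.inv_hom_id]⟩⟩⟩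
  exact isIso_of_mono_of_isSplitEpi b

variable {C : Type u} [Category.{v} C] (E : Cᵒᵖ ⥤ C ⥤ AddCommGrpCat.{w})

@[simp] lemma push_id {Z A : C} (δ : ExtOf E Z A) : push E (𝟙 A) δ = δ := by
  simp [push]

@[simp] lemma pull_id {Z A : C} (δ : ExtOf E Z A) : pull E (𝟙 Z) δ = δ := by
  simp [pull]

lemma push_comp {Z A A' A'' : C} (a : A ⟶ A') (b : A' ⟶ A'') (δ : ExtOf E Z A) :
    push E (a ≫ b) δ = push E b (push E a δ) := by
  simp [push]

lemma pull_comp {Z Z' Z'' A : C} (c : Z'' ⟶ Z') (d : Z' ⟶ Z) (δ : ExtOf E Z A) :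
    pull E (c ≫ d) δ = pull E c (pull E d δ) := by
  simp [pull]

lemma push_pull {Z Z' A A' : C} (a : A ⟶ A') (c : Z' ⟶ Z) (δ : ExtOf E Z A) :
    push E a (pull E c δ) = pull E c (push E a δ) :=
  (ConcreteCategory.congr_hom ((E.map c.op).naturality a) δ).symm

@[simp] lemma push_zero {Z A A' : C} (a : A ⟶ A') : push E a (0 : ExtOf E Z A) = 0 :=
  map_zero _

@[simp] lemma pull_zero {Z Z' A : C} (c : Z' ⟶ Z) : pull E c (0 : ExtOf E Z A) = 0 :=
  map_zero _

lemma push_add {Z A A' : C} (a : A ⟶ A') (δ δ' : ExtOf E Z A) :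
    push E a (δ + δ') = push E a δ + push E a δ' :=
  map_add _ _ _

lemma pull_add {Z Z' A : C} (c : Z' ⟶ Z) (δ δ' : ExtOf E Z A) :
    pull E c (δ + δ') = pull E c δ + pull E c δ' :=
  map_add _ _ _

lemma seqClass_comp_iso {A B B' Z : C} (b : B ≅ B') (x : A ⟶ B) (y : B' ⟶ Z) :
    seqClass x (b.hom ≫ y) = seqClass (x ≫ b.hom) y :=
  Quotient.sound ⟨b, rfl, rfl⟩

lemma exists_iso_of_seqClass_eq {A B B' Z : C} {x : A ⟶ B} {y : B ⟶ Z} {x' : A ⟶ B'} {y' : B' ⟶ Z}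
    (h : seqClass x y = seqClass x' y') : ∃ b : B ≅ B', x ≫ b.hom = x' ∧ b.hom ≫ y' = y :=
  Quotient.exact h

end Basic

namespace ExtriangulatedStructure

open ZeroObject

variable {C : Type u} [Category.{v} C] [Preadditive C] [HasZeroObject C] [HasBinaryBiproducts C]
  (S : ExtriangulatedStructure.{w} C)

@[simp] lemma zero_push {Z A A' : C} (δ : ExtOf S.E Z A) : push S.E (0 : A ⟶ A') δ = 0 := by
  simpa using S.additive_right Z (0 : A ⟶ A') 0 δ

@[simp] lemma zero_pull {Z Z' A : C} (δ : ExtOf S.E Z A) : pull S.E (0 : Z' ⟶ Z) δ = 0 := by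
  simpa using S.additive_left A (0 : Z' ⟶ Z) 0 δ

lemma exists_realization {Z A : C} (δ : ExtOf S.E Z A) :
    ∃ (B : C) (x : A ⟶ B) (y : B ⟶ Z), S.s δ = seqClass x y := by
  obtain ⟨⟨B, x, y⟩, h⟩ := Quotient.exists_rep (S.s δ)
  exact ⟨B, x, y, h.symm⟩

variable {S}

/-! ### Exact sequences attached to an `E`-triangle. -/

section Exactness

variable {A B Z : C} {δ : ExtOf S.E Z A} {x : A ⟶ B} {y : B ⟶ Z}

/-- As in the next few lemmas, the method is to compare with a split triangle having a zero end
term; its retraction or section supplies the required morphism. -/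
lemma exists_extension (h : S.s δ = seqClass x y) {T : C} (f : A ⟶ T) (hf : push S.E f δ = 0) :
    ∃ g : B ⟶ T, x ≫ g = f := by
  obtain ⟨b, hb, -⟩ := S.realization δ 0 x y _ _ f (0 : Z ⟶ 0) h (S.s_zero 0 T) (by simp [hf])
  exact ⟨b ≫ biprod.fst, by rw [← Category.assoc, hb]; simp⟩

lemma push_comp_eq_zero (h : S.s δ = seqClass x y) {T : C} (g : B ⟶ T) :
    push S.E (x ≫ g) δ = 0 := by
  obtain ⟨c, hc, -⟩ := S.et3 δ 0 x y _ _ (x ≫ g) (g ≫ biprod.inl) h (S.s_zero 0 T) (by simp)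
  simpa using hc

lemma exists_lift (h : S.s δ = seqClass x y) {T : C} (f : T ⟶ Z) (hf : pull S.E f δ = 0) :
    ∃ g : T ⟶ B, g ≫ y = f := by
  obtain ⟨b, -, hb⟩ := S.realization 0 δ _ _ x y (0 : 0 ⟶ A) f (S.s_zero T 0) h (by simp [hf])
  exact ⟨biprod.inr ≫ b, by simp [← hb]⟩

lemma pull_comp_eq_zero (h : S.s δ = seqClass x y) {T : C} (g : T ⟶ B) :
    pull S.E (g ≫ y) δ = 0 := by
  obtain ⟨c, hc, -⟩ := S.et3_op 0 δ _ _ x y (biprod.snd ≫ g) (g ≫ y) (S.s_zero T 0) h (by simp)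
  simpa using hc.symm

lemma exists_desc (h : S.s δ = seqClass x y) {T : C} (g : B ⟶ T) (hg : x ≫ g = 0) :
    ∃ t : Z ⟶ T, y ≫ t = g := by
  obtain ⟨c, -, hc⟩ := S.et3 δ 0 x y _ _ (0 : A ⟶ 0) (g ≫ biprod.inr) h (S.s_zero T 0)
    (by simp [← Category.assoc, hg])
  exact ⟨c, by simpa using hc⟩

lemma exists_push_eq (h : S.s δ = seqClass x y) {T : C} (η : ExtOf S.E Z T)
    (hη : pull S.E y η = 0) : ∃ f : A ⟶ T, push S.E f δ = η := by
  obtain ⟨M, p, q, hM⟩ := S.exists_realization η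
  obtain ⟨g, hg⟩ := exists_lift hM y hη
  obtain ⟨a, ha, -⟩ := S.et3_op δ η x y p q g (𝟙 Z) h hM (by simp [hg])
  exact ⟨a, by simpa using ha⟩

lemma exists_pull_eq (h : S.s δ = seqClass x y) {T : C} (η : ExtOf S.E T A)
    (hη : push S.E x η = 0) : ∃ f : T ⟶ Z, pull S.E f δ = η := by
  obtain ⟨M, p, q, hM⟩ := S.exists_realization η
  obtain ⟨g, hg⟩ := exists_extension hM x hη
  obtain ⟨c, hc, -⟩ := S.et3 η δ p q x y (𝟙 A) g hM h (by simp [hg])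
  exact ⟨c, by simpa using hc.symm⟩

/-- (ET4) yields `δ'` with `push x δ' = pull e η`, where `e` is the deflation of a triangle
realizing `push y η`. As that class is zero, `e` has a section, and pulling `δ'` back along it gives
`θ`. -/
lemma exists_push_inflation_eq (h : S.s δ = seqClass x y) {T : C} (η : ExtOf S.E T B)
    (hη : push S.E y η = 0) : ∃ θ : ExtOf S.E T A, push S.E x θ = η := by
  obtain ⟨M, p, q, hM⟩ := S.exists_realization η
  obtain ⟨X, -, -, d, e, δ', -, -, -, -, he, -, hδ'⟩ := S.et4 δ η x y p q h hM
  rw [hη] at he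
  obtain ⟨r, hr⟩ := exists_lift he (𝟙 T) (by simp)
  exact ⟨pull S.E r δ', by rw [push_pull, hδ', ← pull_comp, hr, pull_id]⟩

end Exactness

/-! ### Invariance of conflations under isomorphism. -/

section Isomorphisms

variable {A B Z : C} {x : A ⟶ B} {y : B ⟶ Z}

/-- The difference `b - 𝟙` factors through `y` and is killed by `y`, so it squares to zero; the
inverse of `b` is `2 - b`. -/
lemma isIso_of_comp_eq {δ : ExtOf S.E Z A} (h : S.s δ = seqClass x y) (b : B ⟶ B)
    (hx : x ≫ b = x) (hy : b ≫ y = y) : IsIso b := by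
  obtain ⟨t, ht⟩ := exists_desc h (b - 𝟙 B) (by simp [hx])
  have hsq : (b - 𝟙 B) ≫ (b - 𝟙 B) = 0 := by
    nth_rewrite 2 [← ht]
    rw [← Category.assoc]
    simp [hy]
  have hsq' : b ≫ b = b + b - 𝟙 B := by
    simp only [Preadditive.sub_comp, Preadditive.comp_sub, Category.comp_id,
      Category.id_comp] at hsq
    rw [← sub_eq_zero, ← hsq]
    abel
  exact ⟨𝟙 B + 𝟙 B - b, by simp [hsq'], by simp [hsq']⟩

lemma IsConflation.comp_iso (h : S.IsConflation x y) {Z' : C} (e : Z ≅ Z') :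
    S.IsConflation x (y ≫ e.hom) := by
  obtain ⟨δ, h⟩ := h
  obtain ⟨B', x', y', h'⟩ := S.exists_realization (pull S.E e.inv δ)
  obtain ⟨b, hb, hb'⟩ := S.realization δ _ x y x' y' (𝟙 A) e.hom h h'
    (by simp [← pull_comp])
  obtain ⟨c, hc, hc'⟩ := S.realization _ δ x' y' x y (𝟙 A) e.inv h' h (by simp)
  simp only [Category.id_comp] at hb hc
  have : IsIso b := isIso_of_isIso_comp b c
    (isIso_of_comp_eq h _ (by rw [← Category.assoc, hb, hc])
      (by rw [Category.assoc, ← hc', ← Category.assoc, ← hb']; simp))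
    (isIso_of_comp_eq h' _ (by rw [← Category.assoc, hc, hb])
      (by rw [Category.assoc, ← hb', ← Category.assoc, ← hc']; simp))
  exact ⟨_, by rw [h', hb', ← hb]; exact (seqClass_comp_iso (asIso b) x y').symm⟩

lemma IsConflation.iso_comp (h : S.IsConflation x y) {A' : C} (e : A' ≅ A) :
    S.IsConflation (e.hom ≫ x) y := by
  obtain ⟨δ, h⟩ := h
  obtain ⟨B', x', y', h'⟩ := S.exists_realization (push S.E e.inv δ)
  obtain ⟨b, hb, hb'⟩ := S.realization δ _ x y x' y' e.inv (𝟙 Z) h h' (by simp)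
  obtain ⟨c, hc, hc'⟩ := S.realization _ δ x' y' x y e.hom (𝟙 Z) h' h (by simp [← push_comp])
  simp only [Category.comp_id] at hb' hc'
  have : IsIso c := isIso_of_isIso_comp c b
    (isIso_of_comp_eq h' _ (by rw [← Category.assoc, hc, Category.assoc, hb]; simp)
      (by rw [Category.assoc, ← hb', ← hc']))
    (isIso_of_comp_eq h _ (by rw [← Category.assoc, hb, Category.assoc, hc]; simp)
      (by rw [Category.assoc, ← hc', ← hb']))
  exact ⟨_, by rw [h', hc', ← hc]; exact seqClass_comp_iso (asIso c) x' y⟩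

variable (S) in
lemma isConflation_of_iso {A' : C} (e : A ≅ A') : S.IsConflation e.hom (0 : A' ⟶ (0 : C)) := by
  refine ⟨0, (S.s_zero 0 A).trans ?_⟩
  exact Quotient.sound ⟨⟨biprod.fst ≫ e.hom, e.inv ≫ biprod.inl, by ext; simp, by simp⟩,
    by simp, (isZero_zero C).eq_of_tgt _ _⟩

variable (S) in
lemma isConflation_zero_of_iso {A' : C} (e : A ≅ A') :
    S.IsConflation (0 : (0 : C) ⟶ A) e.hom := by
  refine ⟨0, (S.s_zero A' 0).trans ?_⟩
  exact Quotient.sound ⟨⟨biprod.snd ≫ e.inv, e.hom ≫ biprod.inr, by ext; simp, by simp⟩,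
    (isZero_zero C).eq_of_src _ _, by simp⟩

end Isomorphisms

/-! ### Diagram constructions from (ET4): compositions, pullbacks, pushouts, horseshoes. -/

section Constructions

lemma exists_comp_inflation {L M N X Y : C} {x : L ⟶ M} {y : M ⟶ N} {i : M ⟶ X} {p : X ⟶ Y}
    (h : S.IsConflation x y) (h' : S.IsConflation i p) :
    ∃ (Q : C) (q : X ⟶ Q) (j : N ⟶ Q) (r : Q ⟶ Y),
      S.IsConflation (x ≫ i) q ∧ S.IsConflation j r := by
  obtain ⟨δ, h⟩ := h
  obtain ⟨δ', h'⟩ := h'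
  obtain ⟨Q, _, q, j, r, _, rfl, -, -, h₁, h₂, -, -⟩ := S.et4 δ δ' x y i p h h'
  exact ⟨Q, q, j, r, ⟨_, h₁⟩, ⟨_, h₂⟩⟩

lemma exists_comp_deflation {L M N X Y : C} {x : L ⟶ M} {y : M ⟶ N} {i : Y ⟶ X} {p : X ⟶ M}
    (h : S.IsConflation x y) (h' : S.IsConflation i p) :
    ∃ (Q : C) (q : Q ⟶ X) (j : Y ⟶ Q) (r : Q ⟶ L),
      S.IsConflation q (p ≫ y) ∧ S.IsConflation j r := by
  obtain ⟨δ, h⟩ := h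
  obtain ⟨δ', h'⟩ := h'
  obtain ⟨Q, q, _, j, r, _, rfl, -, -, h₁, h₂, -, -⟩ := S.et4_op δ' δ i p x y h' h
  exact ⟨Q, q, j, r, ⟨_, h₁⟩, ⟨_, h₂⟩⟩

/-- Pulling a conflation `A ⟶ M ⟶ N` back along an inflation. -/
lemma exists_pull_inflation {A M X Y N : C} {x : A ⟶ M} {y : M ⟶ N} {i : N ⟶ X} {p : X ⟶ Y}
    {δ : ExtOf S.E X A} (h : S.s (pull S.E i δ) = seqClass x y) (h' : S.IsConflation i p) :
    ∃ (M' : C) (x' : A ⟶ M') (y' : M' ⟶ X) (j : M ⟶ M') (r : M' ⟶ Y),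
      S.IsConflation x' y' ∧ S.IsConflation j r := by
  obtain ⟨M', x', y', hM'⟩ := S.exists_realization δ
  obtain ⟨δ', h'⟩ := h'
  obtain ⟨Q, j, r, d, e, _, -, -, -, h₁, h₂, -, -⟩ := S.et4_op δ δ' x' y' i p hM' h'
  obtain ⟨b, -, -⟩ := exists_iso_of_seqClass_eq (h.symm.trans h₂)
  exact ⟨M', x', y', b.hom ≫ j, r, ⟨_, hM'⟩, IsConflation.iso_comp ⟨_, h₁⟩ b⟩

/-- Pushing a conflation `L ⟶ M ⟶ Z` out along a deflation. -/
lemma exists_push_deflation {Z M X Y L : C} {x : L ⟶ M} {y : M ⟶ Z} {i : Y ⟶ X} {p : X ⟶ L}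
    {δ : ExtOf S.E Z X} (h : S.s (push S.E p δ) = seqClass x y) (h' : S.IsConflation i p) :
    ∃ (M' : C) (x' : X ⟶ M') (y' : M' ⟶ Z) (j : Y ⟶ M') (r : M' ⟶ M),
      S.IsConflation x' y' ∧ S.IsConflation j r := by
  obtain ⟨M', x', y', hM'⟩ := S.exists_realization δ
  obtain ⟨δ', h'⟩ := h'
  obtain ⟨Q, j, r, d, e, _, -, -, -, h₁, h₂, -, -⟩ := S.et4 δ' δ i p x' y' h' hM'
  obtain ⟨b, -, -⟩ := exists_iso_of_seqClass_eq (h₂.symm.trans h)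
  exact ⟨M', x', y', j, r ≫ b.hom, ⟨_, hM'⟩, IsConflation.comp_iso ⟨_, h₁⟩ b⟩

lemma swap_realization (A A' : C) :
    S.s (0 : ExtOf S.E A A') = seqClass (biprod.inr : A' ⟶ A ⊞ A') (biprod.fst : A ⊞ A' ⟶ A) :=
  (S.s_zero A A').trans (Quotient.sound ⟨biprod.braiding _ _, by ext <;> simp, by simp⟩)

/-- The pullback of two deflations with the same target. -/
lemma exists_pullback {A B A' B' Z : C} {x : A ⟶ B} {y : B ⟶ Z} {x' : A' ⟶ B'} {y' : B' ⟶ Z}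
    (h : S.IsConflation x y) (h' : S.IsConflation x' y') :
    ∃ (M : C) (i : A ⟶ M) (p : M ⟶ B') (i' : A' ⟶ M) (p' : M ⟶ B),
      S.IsConflation i p ∧ S.IsConflation i' p' := by
  obtain ⟨δ, h⟩ := h
  obtain ⟨δ', h'⟩ := h'
  -- The pullback is the middle term of the extension with components `δ` and `δ'`. Its quotient by
  -- `A` realizes the component `δ'`, hence is `B'`; symmetrically for `A'` and `B`.
  let μ : ExtOf S.E Z (A ⊞ A') := push S.E biprod.inl δ + push S.E biprod.inr δ'
  obtain ⟨M, f, g, hM⟩ := S.exists_realization μ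
  obtain ⟨Q, _, q, d, e, _, -, -, -, h₁, h₂, -, -⟩ :=
    S.et4 0 μ biprod.inl biprod.snd f g (S.s_zero A' A) hM
  obtain ⟨Q', _, q', d', e', _, -, -, -, h₁', h₂', -, -⟩ :=
    S.et4 0 μ biprod.inr biprod.fst f g (swap_realization A A') hM
  have hμ : push S.E biprod.snd μ = δ' := by simp [μ, push_add, ← push_comp]
  have hμ' : push S.E biprod.fst μ = δ := by simp [μ, push_add, ← push_comp]
  rw [hμ, h'] at h₂
  rw [hμ', h] at h₂'
  obtain ⟨b, -, -⟩ := exists_iso_of_seqClass_eq h₂.symm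
  obtain ⟨b', -, -⟩ := exists_iso_of_seqClass_eq h₂'.symm
  exact ⟨M, _, _, _, _, IsConflation.comp_iso ⟨_, h₁⟩ b, IsConflation.comp_iso ⟨_, h₁'⟩ b'⟩

/-- The pushout of two inflations with the same source. -/
lemma exists_pushout {A B Z B' Z' : C} {x : A ⟶ B} {y : B ⟶ Z} {x' : A ⟶ B'} {y' : B' ⟶ Z'}
    (h : S.IsConflation x y) (h' : S.IsConflation x' y') :
    ∃ (M : C) (i : B' ⟶ M) (p : M ⟶ Z) (i' : B ⟶ M) (p' : M ⟶ Z'),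
      S.IsConflation i p ∧ S.IsConflation i' p' := by
  obtain ⟨δ, h⟩ := h
  obtain ⟨δ', h'⟩ := h'
  let μ : ExtOf S.E (Z ⊞ Z') A := pull S.E biprod.fst δ + pull S.E biprod.snd δ'
  obtain ⟨M, f, g, hM⟩ := S.exists_realization μ
  obtain ⟨Q, q, _, d, e, _, -, -, -, h₁, h₂, -, -⟩ :=
    S.et4_op μ 0 f g biprod.inl biprod.snd hM (S.s_zero Z' Z)
  obtain ⟨Q', q', _, d', e', _, -, -, -, h₁', h₂', -, -⟩ :=
    S.et4_op μ 0 f g biprod.inr biprod.fst hM (swap_realization Z Z')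
  have hμ : pull S.E biprod.inl μ = δ := by simp [μ, pull_add, ← pull_comp]
  have hμ' : pull S.E biprod.inr μ = δ' := by simp [μ, pull_add, ← pull_comp]
  rw [hμ, h] at h₂
  rw [hμ', h'] at h₂'
  obtain ⟨b, -, -⟩ := exists_iso_of_seqClass_eq h₂
  obtain ⟨b', -, -⟩ := exists_iso_of_seqClass_eq h₂'
  exact ⟨M, _, _, _, _, IsConflation.iso_comp ⟨_, h₁'⟩ b', IsConflation.iso_comp ⟨_, h₁⟩ b⟩

/-- The horseshoe lemma for coresolutions. -/
lemma exists_horseshoe_coresolution {L M N X Y X' Y' : C} {x : L ⟶ M} {y : M ⟶ N}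
    {i : L ⟶ X} {p : X ⟶ Y} {i' : N ⟶ X'} {p' : X' ⟶ Y'} (h : S.IsConflation x y)
    (hL : S.IsConflation i p) (hN : S.IsConflation i' p')
    (hsurj : Function.Surjective (pull S.E i' : ExtOf S.E X' X → ExtOf S.E N X)) :
    ∃ (X'' Y'' : C) (f : M ⟶ X'') (g : X'' ⟶ Y'') (a : X ⟶ X'') (b : X'' ⟶ X') (c : Y ⟶ Y'')
      (d : Y'' ⟶ Y'), S.IsConflation f g ∧ S.IsConflation a b ∧ S.IsConflation c d := by
  -- Pushing out along `L ⟶ X` gives a class `μ` in `E(N, X)`. Extending it to `E(X', X)` embeds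
  -- `M'` in `X''` with cone `Y'`, so the composite `M ⟶ M' ⟶ X''` has a cone that is an extension
  -- of `Y'` by `Y`.
  obtain ⟨M', i₁, p₁, i₂, p₂, ⟨μ, h₁⟩, h₂⟩ := exists_pushout h hL
  obtain ⟨ν, rfl⟩ := hsurj μ
  obtain ⟨X'', a, b, j, r, hab, hj⟩ := exists_pull_inflation h₁ hN
  obtain ⟨Y'', g, c, d, hg, hcd⟩ := exists_comp_inflation h₂ hj
  exact ⟨X'', Y'', _, g, a, b, c, d, hg, hab, hcd⟩

/-- The horseshoe lemma for resolutions. -/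
lemma exists_horseshoe_resolution {L M N X Y X' Y' : C} {x : L ⟶ M} {y : M ⟶ N}
    {i : Y ⟶ X} {p : X ⟶ L} {i' : Y' ⟶ X'} {p' : X' ⟶ N} (h : S.IsConflation x y)
    (hL : S.IsConflation i p) (hN : S.IsConflation i' p')
    (hsurj : Function.Surjective (push S.E p : ExtOf S.E X' X → ExtOf S.E X' L)) :
    ∃ (X'' Y'' : C) (f : Y'' ⟶ X'') (g : X'' ⟶ M) (a : X ⟶ X'') (b : X'' ⟶ X') (c : Y ⟶ Y'')
      (d : Y'' ⟶ Y'), S.IsConflation f g ∧ S.IsConflation a b ∧ S.IsConflation c d := by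
  obtain ⟨M', i₁, p₁, i₂, p₂, ⟨μ, h₁⟩, h₂⟩ := exists_pullback h hN
  obtain ⟨ν, rfl⟩ := hsurj μ
  obtain ⟨X'', a, b, j, r, hab, hj⟩ := exists_push_deflation h₁ hL
  obtain ⟨Y'', f, c, d, hf, hcd⟩ := exists_comp_deflation h₂ hj
  exact ⟨X'', Y'', f, _, a, b, c, d, hf, hab, hcd⟩

end Constructions

end ExtriangulatedStructure

end Extri

namespace Extri

namespace ExtriangulatedStructure

open ZeroObject

variable {C : Type u} [Category.{v} C] [Preadditive C] [HasZeroObject C] [HasBinaryBiproducts C]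
  {S : ExtriangulatedStructure.{w} C}

/-! ### Vanishing of extensions and dimension shifting. -/

section Orthogonality

variable (S) in
/-- `E(A, B) = 0`. -/
def Vanishes (A B : C) : Prop := ∀ δ : ExtOf S.E A B, δ = 0

lemma IsProjective.vanishes {P : C} (hP : S.IsProjective P) (B : C) : S.Vanishes P B := by
  intro δ
  obtain ⟨M, x, y, h⟩ := S.exists_realization δ
  obtain ⟨b, hb⟩ := hP x y ⟨δ, h⟩ (𝟙 P)
  simpa [hb] using pull_comp_eq_zero h b

lemma IsInjective.vanishes {I : C} (hI : S.IsInjective I) (A : C) : S.Vanishes A I := by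
  intro δ
  obtain ⟨M, x, y, h⟩ := S.exists_realization δ
  obtain ⟨b, hb⟩ := hI x y ⟨δ, h⟩ (𝟙 I)
  simpa [hb] using push_comp_eq_zero h b

variable {A₁ A₂ A₃ : C} {x : A₁ ⟶ A₂} {y : A₂ ⟶ A₃}

lemma Vanishes.of_extension_right (h : S.IsConflation x y) {B : C} (h₁ : S.Vanishes B A₁)
    (h₃ : S.Vanishes B A₃) : S.Vanishes B A₂ := by
  obtain ⟨δ, h⟩ := h
  intro η
  obtain ⟨θ, rfl⟩ := exists_push_inflation_eq h η (h₃ _)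
  rw [h₁ θ, push_zero]

variable {K P A B I J : C} {k : K ⟶ P} {p : P ⟶ A} {i : B ⟶ I} {j : I ⟶ J}

/-- Dimension shift: a syzygy in the first variable is traded for a cosyzygy in the second. -/
lemma vanishes_syzygy_iff (hA : S.IsConflation k p) (hP : S.IsProjective P)
    (hB : S.IsConflation i j) (hI : S.IsInjective I) : S.Vanishes K B ↔ S.Vanishes A J := by
  obtain ⟨ε, hε⟩ := id hA
  obtain ⟨ι, hι⟩ := id hB
  constructor
  · intro h δ
    obtain ⟨f, rfl⟩ := exists_push_eq hε δ (hP.vanishes _ _)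
    obtain ⟨g, rfl⟩ := exists_lift hι f (h _)
    obtain ⟨g', rfl⟩ := hI k p hA g
    rw [Category.assoc, push_comp_eq_zero hε]
  · intro h δ
    obtain ⟨f, rfl⟩ := exists_pull_eq hι δ (hI.vanishes _ _)
    obtain ⟨g, rfl⟩ := exists_extension hε f (h _)
    obtain ⟨g', rfl⟩ := hP i j hB g
    rw [← Category.assoc, pull_comp_eq_zero hι]

/-- Extensions by `B` extend along an inflation whose cone has no extensions by the cosyzygy
of `B`. -/
lemma pull_inflation_surjective (h : S.IsConflation x y) (hB : S.IsConflation i j)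
    (hI : S.IsInjective I) (hv : S.Vanishes A₃ J) :
    Function.Surjective (pull S.E x : ExtOf S.E A₂ B → ExtOf S.E A₁ B) := by
  obtain ⟨δ, h⟩ := h
  obtain ⟨ι, hι⟩ := hB
  intro η
  obtain ⟨f, rfl⟩ := exists_pull_eq hι η (hI.vanishes _ _)
  obtain ⟨g, rfl⟩ := exists_extension h f (hv _)
  exact ⟨pull S.E g ι, (pull_comp ..).symm⟩

lemma Vanishes.of_cone (h : S.IsConflation x y) (hA : S.IsConflation k p)
    (hP : S.IsProjective P) (h₁ : S.Vanishes K A₁) (h₂ : S.Vanishes A A₂) : S.Vanishes A A₃ := by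
  obtain ⟨δ, h⟩ := h
  obtain ⟨ε, hε⟩ := hA
  intro η
  obtain ⟨f, rfl⟩ := exists_push_eq hε η (hP.vanishes _ _)
  obtain ⟨g, rfl⟩ := exists_lift h f (h₁ _)
  rw [push_comp, h₂ (push S.E g ε), push_zero]

variable [S.EnoughProjectives]

variable (S) in
lemma exists_syzygy_conflation (X : C) : ∃ (P : C) (x : S.syzygy X ⟶ P) (y : P ⟶ X),
    S.IsConflation x y ∧ S.IsProjective P :=
  (EnoughProjectives.exists_conflation (S := S) X).choose_spec

variable (S) in
/-- `E^i(A, B) = 0` for all `i ≥ 1`. -/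
def Orthogonal (A B : C) : Prop := ∀ i : ℕ, S.Vanishes (S.iterSyzygy i A) B

lemma Orthogonal.cone (h : S.IsConflation x y) {B : C} (h₁ : S.Orthogonal B A₁)
    (h₂ : S.Orthogonal B A₂) : S.Orthogonal B A₃ := by
  intro n
  obtain ⟨P, k, p, hA, hP⟩ := S.exists_syzygy_conflation (S.iterSyzygy n B)
  exact Vanishes.of_cone h hA hP (h₁ (n + 1)) (h₂ n)

lemma rightPerp_closedUnderExtensions (ω : ObjectProperty C) :
    S.ClosedUnderExtensions (S.rightPerp ω) :=
  fun _ _ h hL hN _ hX n => Vanishes.of_extension_right h (hL _ hX n) (hN _ hX n)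

lemma rightPerp_closedUnderCones (ω : ObjectProperty C) :
    S.ClosedUnderCones (S.rightPerp ω) :=
  fun _ _ h hL hM X hX => Orthogonal.cone h (hL X hX) (hM X hX)

lemma Orthogonal.cosyzygy (hB : S.IsConflation i j) (hI : S.IsInjective I)
    (h : S.Orthogonal A B) : S.Orthogonal A J := by
  intro n
  obtain ⟨P, k, p, hA, hP⟩ := S.exists_syzygy_conflation (S.iterSyzygy n A)
  exact (vanishes_syzygy_iff hA hP hB hI).1 (h (n + 1))

variable [S.EnoughInjectives]

lemma Orthogonal.pull_surjective (h : S.IsConflation x y) {B : C} (h₃ : S.Orthogonal A₃ B) :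
    Function.Surjective (pull S.E x : ExtOf S.E A₂ B → ExtOf S.E A₁ B) := by
  obtain ⟨J, I, i, j, hB, hI⟩ := EnoughInjectives.exists_conflation (S := S) B
  exact pull_inflation_surjective h hB hI (h₃.cosyzygy hB hI 0)

/-- The chosen syzygies of `A₁`, `A₂`, `A₃` need not form triangles, so the induction shifts to
cosyzygies of `B` and leaves the triangle fixed. -/
lemma Orthogonal.cocone (h : S.IsConflation x y) {B : C} (h₂ : S.Orthogonal A₂ B)
    (h₃ : S.Orthogonal A₃ B) : S.Orthogonal A₁ B := by
  have key : ∀ B : C, S.Orthogonal A₂ B → S.Orthogonal A₃ B → S.Vanishes A₁ B := by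
    intro B h₂ h₃ η
    obtain ⟨θ, rfl⟩ := h₃.pull_surjective h η
    rw [show θ = 0 from h₂ 0 θ, pull_zero]
  intro n
  induction n generalizing B with
  | zero => exact key B h₂ h₃
  | succ n ih =>
    obtain ⟨J, I, i, j, hB, hI⟩ := EnoughInjectives.exists_conflation (S := S) B
    obtain ⟨P, k, p, hA, hP⟩ := S.exists_syzygy_conflation (S.iterSyzygy n A₁)
    exact (vanishes_syzygy_iff hA hP hB hI).2
      (ih (h₂.cosyzygy hB hI) (h₃.cosyzygy hB hI))

end Orthogonality

end ExtriangulatedStructure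

end Extri

namespace Extri

open ZeroObject in
lemma IsAdditiveSubcategory.zero_mem {C : Type u} [Category.{v} C] [Preadditive C]
    [HasZeroObject C] [HasBinaryBiproducts C] {ω : ObjectProperty C}
    (hω : IsAdditiveSubcategory ω) : ω 0 :=
  hω.zero 0 (isZero_zero C)

namespace ExtriangulatedStructure

open ZeroObject

variable {C : Type u} [Category.{v} C] [Preadditive C] [HasZeroObject C] [HasBinaryBiproducts C]
  {S : ExtriangulatedStructure.{w} C} {ω X : ObjectProperty C}

/-! ### Elementary properties of `check` and `hat`. -/

section Resolutions

lemma checkN_le_succ (h₀ : X 0) (n : ℕ) : S.checkN X n ≤ S.checkN X (n + 1) := by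
  induction n with
  | zero =>
    rintro A ⟨W, hW, ⟨e⟩⟩
    exact ⟨0, W, _, _, hW, ⟨0, h₀, ⟨Iso.refl _⟩⟩, S.isConflation_of_iso e⟩
  | succ n ih =>
    rintro A ⟨K, W, g, f, hW, hK, h⟩
    exact ⟨K, W, g, f, hW, ih _ hK, h⟩

lemma hatN_le_succ (h₀ : X 0) (n : ℕ) : S.hatN X n ≤ S.hatN X (n + 1) := by
  induction n with
  | zero =>
    rintro A ⟨W, hW, ⟨e⟩⟩
    exact ⟨0, W, _, _, hW, ⟨0, h₀, ⟨Iso.refl _⟩⟩, S.isConflation_zero_of_iso e⟩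
  | succ n ih =>
    rintro A ⟨K, W, g, f, hW, hK, h⟩
    exact ⟨K, W, g, f, hW, ih _ hK, h⟩

lemma checkN_mono (h₀ : X 0) {m n : ℕ} (h : m ≤ n) : S.checkN X m ≤ S.checkN X n :=
  monotone_nat_of_le_succ (checkN_le_succ h₀) h

lemma hatN_mono (h₀ : X 0) {m n : ℕ} (h : m ≤ n) : S.hatN X m ≤ S.hatN X n :=
  monotone_nat_of_le_succ (hatN_le_succ h₀) h

lemma le_check : X ≤ S.check X := fun A hA => ⟨0, A, hA, ⟨Iso.refl A⟩⟩

lemma le_hat : X ≤ S.hat X := fun A hA => ⟨0, A, hA, ⟨Iso.refl A⟩⟩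

lemma check_monotone {Y : ObjectProperty C} (h : X ≤ Y) : S.check X ≤ S.check Y := by
  rintro A ⟨n, hA⟩
  refine ⟨n, ?_⟩
  induction n generalizing A with
  | zero =>
    obtain ⟨W, hW, e⟩ := hA
    exact ⟨W, h _ hW, e⟩
  | succ n ih =>
    obtain ⟨K, W, g, f, hW, hK, hc⟩ := hA
    exact ⟨K, W, g, f, h _ hW, ih K hK, hc⟩

lemma check_of_conflation {A W K : C} {g : A ⟶ W} {f : W ⟶ K} (h : S.IsConflation g f)
    (hW : X W) (hK : S.check X K) : S.check X A := by
  obtain ⟨n, hn⟩ := hK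
  exact ⟨n + 1, K, W, g, f, hW, hn, h⟩

lemma hat_of_conflation {A W K : C} {g : K ⟶ W} {f : W ⟶ A} (h : S.IsConflation g f)
    (hW : X W) (hK : S.hat X K) : S.hat X A := by
  obtain ⟨n, hn⟩ := hK
  exact ⟨n + 1, K, W, g, f, hW, hn, h⟩

lemma exists_conflation_of_check (h₀ : X 0) {A : C} (hA : S.check X A) :
    ∃ (W K : C) (g : A ⟶ W) (f : W ⟶ K), S.IsConflation g f ∧ X W ∧ S.check X K := by
  obtain ⟨n, hn⟩ := hA
  obtain ⟨K, W, g, f, hW, hK, h⟩ := checkN_le_succ h₀ n _ hn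
  exact ⟨W, K, g, f, h, hW, n, hK⟩

lemma exists_conflation_of_hat (h₀ : X 0) {A : C} (hA : S.hat X A) :
    ∃ (K W : C) (g : K ⟶ W) (f : W ⟶ A), S.IsConflation g f ∧ X W ∧ S.hat X K := by
  obtain ⟨n, hn⟩ := hA
  obtain ⟨K, W, g, f, hW, hK, h⟩ := hatN_le_succ h₀ n _ hn
  exact ⟨K, W, g, f, h, hW, n, hK⟩

end Resolutions

/-! ### The class `check ω` for self-orthogonal `ω`. -/

section SelfOrthogonal

variable [S.EnoughProjectives]

lemma closedUnderExtensions_of_selfOrthogonal (hω : IsAdditiveSubcategory ω)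
    (hself : S.IsSelfOrthogonal ω) : S.ClosedUnderExtensions ω := by
  rintro L M N x y ⟨δ, h⟩ hL hN
  obtain rfl : δ = 0 := hself L hL N hN 0 δ
  rw [S.s_zero] at h
  obtain ⟨b, -, -⟩ := exists_iso_of_seqClass_eq h
  exact hω.iso b (hω.sum hL hN)

lemma check_orthogonal [S.EnoughInjectives] {B : C} (hB : S.rightPerp ω B) (hω₀ : ω 0) {A : C}
    (hA : S.check ω A) : S.Orthogonal A B := by
  obtain ⟨n, hA⟩ := hA
  -- Raising the length by one makes a triangle available in the base case too.
  replace hA := checkN_le_succ hω₀ n _ hA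
  induction n generalizing A with
  | zero =>
    obtain ⟨K, W, g, f, hW, ⟨K', hK', ⟨e⟩⟩, h⟩ := hA
    refine Orthogonal.cocone h (hB W hW) ?_
    exact Orthogonal.cocone (S.isConflation_of_iso e) (hB _ hK') (hB _ hω₀)
  | succ n ih =>
    obtain ⟨K, W, g, f, hW, hK, h⟩ := hA
    exact Orthogonal.cocone h (hB W hW) (ih hK)

lemma check_closedUnderExtensions [S.EnoughInjectives] (hω : IsAdditiveSubcategory ω)
    (hself : S.IsSelfOrthogonal ω) : S.ClosedUnderExtensions (S.check ω) := by
  have hω₀ : ω 0 := hω.zero_mem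
  have hext : S.ClosedUnderExtensions ω := closedUnderExtensions_of_selfOrthogonal hω hself
  have key : ∀ (n : ℕ) {L M N : C} (x : L ⟶ M) (y : M ⟶ N), S.IsConflation x y →
      S.checkN ω n L → S.checkN ω n N → S.check ω M := by
    intro n
    induction n with
    | zero =>
      rintro L M N x y h ⟨L', hL', ⟨e⟩⟩ ⟨N', hN', ⟨e'⟩⟩
      exact le_check _ (hext x y h (hω.iso e.symm hL') (hω.iso e'.symm hN'))
    | succ n ih =>
      rintro L M N x y h ⟨K, W, g, f, hW, hK, hL⟩ ⟨K', W', g', f', hW', hK', hN⟩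
      obtain ⟨W'', K'', _, _, _, _, _, _, h₁, h₂, h₃⟩ := exists_horseshoe_coresolution h hL hN
        (Orthogonal.pull_surjective hN (check_orthogonal (hself W hW) hω₀ ⟨n, hK'⟩))
      exact check_of_conflation h₁ (hext _ _ h₂ hW hW') (ih _ _ h₃ hK hK')
  rintro L M N x y h ⟨m, hL⟩ ⟨n, hN⟩
  exact key (max m n) x y h (checkN_mono hω₀ (le_max_left m n) _ hL)
    (checkN_mono hω₀ (le_max_right m n) _ hN)

end SelfOrthogonal

/-! ### Approximations and closure properties of `check X`. -/

section RelativeGenerator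

variable [S.EnoughProjectives]

variable (S) in
/-- `ω` is a relative generator of the class `X`, which is contained in `ω^⊥` and closed under
extensions and under cones of inflations. -/
structure IsRelativeGenerator (ω X : ObjectProperty C) : Prop where
  le : ω ≤ X
  le_rightPerp : X ≤ S.rightPerp ω
  extensions : S.ClosedUnderExtensions X
  cones : S.ClosedUnderCones X
  exists_conflation : ∀ A : C, X A → ∃ (K W : C) (g : K ⟶ W) (f : W ⟶ A),
    S.IsConflation g f ∧ ω W ∧ X K

/-- The class `X` is closed under cones of inflations as soon as `ω` has the other properties of a
relative generator of `X`, and cones in `ω^⊥` of morphisms from `X` to `ω` lie in `X`. -/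
lemma closedUnderCones_of_generator (hext : S.ClosedUnderExtensions X)
    (hX : X ≤ S.rightPerp ω)
    (hgen : ∀ A : C, X A → ∃ (K W : C) (g : K ⟶ W) (f : W ⟶ A),
      S.IsConflation g f ∧ ω W ∧ X K)
    (hcone : ∀ {K W A : C} (g : K ⟶ W) (f : W ⟶ A), S.IsConflation g f → X K → ω W →
      S.rightPerp ω A → X A) : S.ClosedUnderCones X := by
  intro L M N x y h hL hM
  obtain ⟨K, W, g, f, hc, hW, hK⟩ := hgen M hM
  -- The deflation `W ⟶ M ⟶ N` has cocone `Q`, an extension of `L` by `K`, so `N` is a cone of a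
  -- morphism from `X` to `ω`.
  obtain ⟨Q, q, j, r, h₁, h₂⟩ := exists_comp_deflation h hc
  exact hcone _ _ h₁ (hext _ _ h₂ hK hL) hW
    (rightPerp_closedUnderCones ω _ _ h (hX _ hL) (hX _ hM))

variable (hω : IsAdditiveSubcategory ω) (hself : S.IsSelfOrthogonal ω)
  (hX : S.IsRelativeGenerator ω X)

include hω hX

lemma IsRelativeGenerator.exists_precover {A : C} (hA : S.check X A) :
    ∃ (K Y : C) (g : K ⟶ Y) (f : Y ⟶ A), S.IsConflation g f ∧ X K ∧ S.check ω Y := by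
  have hω₀ := hω.zero_mem
  obtain ⟨n, hA⟩ := hA
  replace hA := checkN_le_succ (hX.le _ hω₀) n _ hA
  -- An envelope turns into a cover: compose `W ⟶ E ⟶ Y` with `W` in `ω` and take the cocone, which
  -- lies in `check ω`.
  have key : ∀ {A E Y : C} (g : A ⟶ E) (f : E ⟶ Y), S.IsConflation g f → X E → S.check ω Y →
      ∃ (K Y : C) (g : K ⟶ Y) (f : Y ⟶ A), S.IsConflation g f ∧ X K ∧ S.check ω Y := by
    intro A E Y g f h hE hY
    obtain ⟨K, W, g', f', hc, hW, hK⟩ := hX.exists_conflation E hE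
    obtain ⟨Q, q, j, r, h₁, h₂⟩ := exists_comp_deflation h hc
    exact ⟨K, Q, j, r, h₂, hK, check_of_conflation h₁ hW hY⟩
  -- The pullback of `E` and the cover of `K` is an extension of `E` by `K'`, hence in `X`, and
  -- serves as an envelope of `A`.
  have step : ∀ {A E K : C} (g : A ⟶ E) (f : E ⟶ K), S.IsConflation g f → X E →
      (∃ (K' Y : C) (g' : K' ⟶ Y) (f' : Y ⟶ K), S.IsConflation g' f' ∧ X K' ∧ S.check ω Y) →
      ∃ (K Y : C) (g : K ⟶ Y) (f : Y ⟶ A), S.IsConflation g f ∧ X K ∧ S.check ω Y := by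
    rintro A E K g f h hE ⟨K', Y, g', f', h', hK', hY⟩
    obtain ⟨M, i, p, i', p', h₁, h₂⟩ := exists_pullback h h'
    exact key i p h₁ (hX.extensions _ _ h₂ hK' hE) hY
  induction n generalizing A with
  | zero =>
    obtain ⟨K, E, g, f, hE, ⟨K', hK', ⟨e⟩⟩, h⟩ := hA
    refine step g f h hE ?_
    exact key _ _ (S.isConflation_of_iso e) hK' (le_check _ hω₀)
  | succ n ih =>
    obtain ⟨K, E, g, f, hE, hK, h⟩ := hA
    exact step g f h hE (ih hK)

/-- Embed the middle term `Y` of a cover into `W` in `ω`: the cone of `K ⟶ W` lies in `X` and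
contains `A` with cokernel `Y'`. -/
lemma IsRelativeGenerator.exists_preenvelope {A : C} (hA : S.check X A) :
    ∃ (E Y : C) (g : A ⟶ E) (f : E ⟶ Y), S.IsConflation g f ∧ X E ∧ S.check ω Y := by
  obtain ⟨K, Y, g, f, h, hK, hY⟩ := hX.exists_precover hω hA
  obtain ⟨W, Y', i, p, h', hW, hY'⟩ := exists_conflation_of_check hω.zero_mem hY
  obtain ⟨Q, q, j, r, h₁, h₂⟩ := exists_comp_inflation h h'
  exact ⟨Q, Y', j, r, h₂, hX.cones _ _ h₁ hK (hX.le _ hW), hY'⟩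

lemma IsRelativeGenerator.check_of_precover {A K Y : C} {g : K ⟶ Y} {f : Y ⟶ A}
    (h : S.IsConflation g f) (hK : X K) (hY : S.check ω Y) : S.check X A := by
  obtain ⟨W, Y', i, p, h', hW, hY'⟩ := exists_conflation_of_check hω.zero_mem hY
  obtain ⟨Q, q, j, r, h₁, h₂⟩ := exists_comp_inflation h h'
  exact check_of_conflation h₂ (hX.cones _ _ h₁ hK (hX.le _ hW)) (check_monotone hX.le _ hY')

variable [S.EnoughInjectives]

include hself

lemma IsRelativeGenerator.check_closedUnderExtensions :
    S.ClosedUnderExtensions (S.check X) := by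
  intro L M N x y h hL hN
  obtain ⟨E, Y, _, _, hL', hE, hY⟩ := hX.exists_preenvelope hω hL
  obtain ⟨E', Y', _, _, hN', hE', hY'⟩ := hX.exists_preenvelope hω hN
  obtain ⟨E'', Y'', _, _, _, _, _, _, h₁, h₂, h₃⟩ := exists_horseshoe_coresolution h hL' hN'
    (Orthogonal.pull_surjective hN'
      (check_orthogonal (hX.le_rightPerp _ hE) hω.zero_mem hY'))
  exact check_of_conflation h₁ (hX.extensions _ _ h₂ hE hE') (check_monotone hX.le _
    (ExtriangulatedStructure.check_closedUnderExtensions hω hself _ _ h₃ hY hY'))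

lemma IsRelativeGenerator.check_closedUnderCocones : S.ClosedUnderCocones (S.check X) := by
  intro L M N x y h hM hN
  obtain ⟨K, Y, g, f, h', hK, hY⟩ := hX.exists_precover hω hN
  -- `P` is an extension of `M` by `K`, so it has an envelope `E`; the cone of `L ⟶ P ⟶ E` is an
  -- extension of `Y'` by `Y`.
  obtain ⟨P, i, p, i', p', h₁, h₂⟩ := exists_pullback h h'
  obtain ⟨E, Y', _, _, h₃, hE, hY'⟩ := hX.exists_preenvelope hω
    (hX.check_closedUnderExtensions hω hself _ _ h₂ (le_check _ hK) hM)
  obtain ⟨Q, q, j, r, h₄, h₅⟩ := exists_comp_inflation h₁ h₃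
  exact check_of_conflation h₄ hE (check_monotone hX.le _
    (ExtriangulatedStructure.check_closedUnderExtensions hω hself _ _ h₅ hY hY'))

lemma IsRelativeGenerator.check_closedUnderCones : S.ClosedUnderCones (S.check X) := by
  intro L M N x y h hL hM
  obtain ⟨K, Y, g, f, h', hK, hY⟩ := hX.exists_precover hω hM
  -- The cocone `Z` of `Y ⟶ M ⟶ N` is an extension of `L` by `K`. Pushing out along its envelope `E`
  -- produces a cover of `N` with kernel `E`.
  obtain ⟨Z, q, j, r, h₁, h₂⟩ := exists_comp_deflation h h'
  obtain ⟨E, Y', _, _, h₃, hE, hY'⟩ := hX.exists_preenvelope hω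
    (hX.check_closedUnderExtensions hω hself _ _ h₂ (le_check _ hK) hL)
  obtain ⟨P, i, p, i', p', h₄, h₅⟩ := exists_pushout h₁ h₃
  exact hX.check_of_precover hω h₄ hE
    (ExtriangulatedStructure.check_closedUnderExtensions hω hself _ _ h₅ hY hY')

end RelativeGenerator

/-! ### The two relative generators: `leftX ω` and `hat ω`. -/

section Examples

variable [S.EnoughProjectives]

lemma exists_conflation_of_leftX {A : C} (hA : S.leftX ω A) :
    ∃ (K W : C) (g : K ⟶ W) (f : W ⟶ A), S.IsConflation g f ∧ ω W ∧ S.leftX ω K := by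
  obtain ⟨W, K, rfl, h⟩ := hA
  obtain ⟨hW, -, g, f, hc⟩ := h 0
  exact ⟨K 1, W 0, g, f, hc, hW, fun n => W (n + 1), fun n => K (n + 1), rfl, fun n => h (n + 1)⟩

lemma leftX_le_rightPerp : S.leftX ω ≤ S.rightPerp ω := by
  rintro A ⟨W, K, rfl, h⟩
  exact (h 0).2.1

/-- The coinduction principle for `leftX`: iterating the choice of triangles builds the infinite
resolution. Membership in `leftX ω` is proved below by exhibiting a suitable class `X`. -/
lemma le_leftX (hperp : X ≤ S.rightPerp ω)
    (hgen : ∀ A : C, X A → ∃ (K W : C) (g : K ⟶ W) (f : W ⟶ A),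
      S.IsConflation g f ∧ ω W ∧ X K) : X ≤ S.leftX ω := by
  intro A hA
  choose K W g f hc hW hK using hgen
  let T : ℕ → {A : C // X A} := fun n => Nat.rec ⟨A, hA⟩ (fun _ B => ⟨K B.1 B.2, hK B.1 B.2⟩) n
  exact ⟨fun n => W (T n).1 (T n).2, fun n => (T n).1, rfl, fun n =>
    ⟨hW _ _, hperp _ (T n).2, g _ (T n).2, f _ (T n).2, hc _ _⟩⟩

lemma leftX_of_conflation {K W A : C} {g : K ⟶ W} {f : W ⟶ A} (h : S.IsConflation g f)
    (hK : S.leftX ω K) (hW : ω W) (hA : S.rightPerp ω A) : S.leftX ω A := by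
  refine le_leftX (X := fun B => B = A ∨ S.leftX ω B) ?_ ?_ A (Or.inl rfl)
  · rintro B (rfl | hB)
    exacts [hA, leftX_le_rightPerp B hB]
  · rintro B (rfl | hB)
    · exact ⟨K, W, g, f, h, hW, Or.inr hK⟩
    · obtain ⟨K', W', g', f', h', hW', hK'⟩ := exists_conflation_of_leftX hB
      exact ⟨K', W', g', f', h', hW', Or.inr hK'⟩

variable (hω : IsAdditiveSubcategory ω) (hself : S.IsSelfOrthogonal ω)

include hω hself

/-- Coinduction on the class of all extensions of objects of `leftX ω`. The horseshoe exists because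
`E(W', L) = 0`, and its kernel is again such an extension. -/
lemma leftX_closedUnderExtensions : S.ClosedUnderExtensions (S.leftX ω) := by
  intro L M N x y h hL hN
  refine le_leftX (X := fun M => ∃ (L N : C) (x : L ⟶ M) (y : M ⟶ N), S.IsConflation x y ∧
    S.leftX ω L ∧ S.leftX ω N) ?_ ?_ M ⟨L, N, x, y, h, hL, hN⟩
  · rintro M ⟨L, N, x, y, h, hL, hN⟩
    exact rightPerp_closedUnderExtensions ω x y h (leftX_le_rightPerp L hL)
      (leftX_le_rightPerp N hN)
  · rintro M ⟨L, N, x, y, h, hL, hN⟩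
    obtain ⟨K, W, g, f, hc, hW, hK⟩ := exists_conflation_of_leftX hL
    obtain ⟨K', W', g', f', hc', hW', hK'⟩ := exists_conflation_of_leftX hN
    obtain ⟨W'', K'', _, _, _, _, _, _, h₁, h₂, h₃⟩ := exists_horseshoe_resolution h hc hc'
      (fun μ => ⟨0, (push_zero _ _).trans (leftX_le_rightPerp L hL W' hW' 0 μ).symm⟩)
    exact ⟨K'', W'', _, _, h₁,
      closedUnderExtensions_of_selfOrthogonal hω hself _ _ h₂ hW hW', K, K', _, _, h₃, hK, hK'⟩

lemma le_leftX_self : ω ≤ S.leftX ω :=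
  le_leftX hself fun A hA => ⟨0, A, 0, 𝟙 A, S.isConflation_zero_of_iso (Iso.refl A), hA,
    hω.zero_mem⟩

lemma leftX_isRelativeGenerator : S.IsRelativeGenerator ω (S.leftX ω) where
  le := le_leftX_self hω hself
  le_rightPerp := leftX_le_rightPerp
  extensions := leftX_closedUnderExtensions hω hself
  cones := closedUnderCones_of_generator (leftX_closedUnderExtensions hω hself)
    leftX_le_rightPerp (fun _ => exists_conflation_of_leftX)
    fun _ _ h hK hW hA => leftX_of_conflation h hK hW hA
  exists_conflation _ := exists_conflation_of_leftX

lemma hat_le_rightPerp : S.hat ω ≤ S.rightPerp ω := by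
  rintro A ⟨n, hA⟩
  induction n generalizing A with
  | zero =>
    obtain ⟨W, hW, ⟨e⟩⟩ := hA
    exact hself _ (hω.iso e hW)
  | succ n ih =>
    obtain ⟨K, W, g, f, hW, hK, h⟩ := hA
    exact rightPerp_closedUnderCones ω g f h (ih K hK) (hself W hW)

lemma hat_closedUnderExtensions : S.ClosedUnderExtensions (S.hat ω) := by
  have hω₀ : ω 0 := hω.zero_mem
  have hext : S.ClosedUnderExtensions ω := closedUnderExtensions_of_selfOrthogonal hω hself
  have key : ∀ (n : ℕ) {L M N : C} (x : L ⟶ M) (y : M ⟶ N), S.IsConflation x y →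
      S.hatN ω n L → S.hatN ω n N → S.hat ω M := by
    intro n
    induction n with
    | zero =>
      rintro L M N x y h ⟨L', hL', ⟨e⟩⟩ ⟨N', hN', ⟨e'⟩⟩
      exact le_hat _ (hext x y h (hω.iso e hL') (hω.iso e' hN'))
    | succ n ih =>
      intro L M N x y h hL hN
      have hL' := hat_le_rightPerp hω hself L ⟨_, hL⟩
      obtain ⟨K, W, g, f, hW, hK, hL⟩ := hL
      obtain ⟨K', W', g', f', hW', hK', hN⟩ := hN
      obtain ⟨W'', K'', _, _, _, _, _, _, h₁, h₂, h₃⟩ := exists_horseshoe_resolution h hL hN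
        (fun μ => ⟨0, (push_zero _ _).trans (hL' W' hW' 0 μ).symm⟩)
      exact hat_of_conflation h₁ (hext _ _ h₂ hW hW') (ih _ _ h₃ hK hK')
  rintro L M N x y h ⟨m, hL⟩ ⟨n, hN⟩
  exact key (max m n) x y h (hatN_mono hω₀ (le_max_left m n) _ hL)
    (hatN_mono hω₀ (le_max_right m n) _ hN)

lemma hat_isRelativeGenerator : S.IsRelativeGenerator ω (S.hat ω) where
  le := le_hat
  le_rightPerp := hat_le_rightPerp hω hself
  extensions := hat_closedUnderExtensions hω hself
  cones := closedUnderCones_of_generator (hat_closedUnderExtensions hω hself)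
    (hat_le_rightPerp hω hself)
    (fun _ => exists_conflation_of_hat hω.zero_mem)
    fun _ _ h hK hW _ => hat_of_conflation h hW hK
  exists_conflation _ := exists_conflation_of_hat hω.zero_mem

end Examples

end ExtriangulatedStructure

end Extri

theorem mainTheorem6 {C : Type u} [Category.{v} C] [Preadditive C] [HasZeroObject C]
    [HasBinaryBiproducts C] (S : Extri.ExtriangulatedStructure.{w} C)
    (hKS : Extri.IsKrullSchmidt C) [S.EnoughProjectives] [S.EnoughInjectives]
    (ω : ObjectProperty C) (hω : Extri.IsAdditiveSubcategory ω)
    (hself : S.IsSelfOrthogonal ω) :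
    (S.ClosedUnderExtensions (S.check (S.leftX ω)) ∧
      S.ClosedUnderCocones (S.check (S.leftX ω)) ∧
      S.ClosedUnderCones (S.check (S.leftX ω))) ∧
    (S.ClosedUnderExtensions (S.tilde ω) ∧
      S.ClosedUnderCocones (S.tilde ω) ∧
      S.ClosedUnderCones (S.tilde ω)) := by

  have hX := Extri.ExtriangulatedStructure.leftX_isRelativeGenerator hω hself
  have hY := Extri.ExtriangulatedStructure.hat_isRelativeGenerator hω hself
  exact ⟨⟨hX.check_closedUnderExtensions hω hself, hX.check_closedUnderCocones hω hself,
    hX.check_closedUnderCones hω hself⟩, hY.check_closedUnderExtensions hω hself,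
    hY.check_closedUnderCocones hω hself, hY.check_closedUnderCones hω hself⟩
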